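/- Let $n \ge 1$ be an integer. For $k, l \ge 0$, a $(k,l)$-partition diagram $d_\pi$ is a set partition $\pi$ of a set of $l+k$ vertices, arranged in a top row of $l$ vertices and a bottom row of $k$ vertices, and $P_k^l(n)$ is the real vector space with basis the $(k,l)$-partition diagrams. The partition category $\mathcal{P}(n)$ has as objects the integers $k \ge 0$, with $\mathrm{Hom}(k,l) = P_k^l(n)$. Its composition is the bilinear map with $d_{\pi_2} \bullet d_{\pi_1} = n^{c(d_{\pi_2}, d_{\pi_1})}\, d_{\pi_2} \circ d_{\pi_1}$, where $d_{\pi_2} \circ d_{\pi_1}$ is obtained by putting $d_{\pi_1}$ below $d_{\pi_2}$, identifying the middle rows, and removing the $c(d_{\pi_2}, d_{\pi_1})$ connected components that lie entirely in the middle row. Its tensor product is $k \otimes q = k+q$ on objects and, on morphisms, the bilinear map that places $d_\pi$ to the left of $d_\tau$; its unit object is $0$. The category $\mathcal{C}(S_n)$ has as objects the pairs $((\mathbb{R}^n)^{\otimes k}, \rho_k)$, $k \ge 0$, where $\rho_k$ is the $k$-th tensor power of the representation of $S_n$ on $\mathbb{R}^n$ that permutes the standard basis, and as morphisms the $S_n$-equivariant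 linear maps. Composition is that of linear maps, the tensor product is that of linear maps (with $(\mathbb{R}^n)^{\otimes k} \otimes (\mathbb{R}^n)^{\otimes q}$ identified with $(\mathbb{R}^n)^{\otimes (k+q)}$), and the unit object is $\mathbb{R} = (\mathbb{R}^n)^{\otimes 0}$ with the trivial representation. Both are strict $\mathbb{R}$-linear monoidal categories: the tensor product is a bifunctor, strictly associative and unital on objects and on morphisms, the morphism spaces are real vector spaces, and composition and the tensor product of morphisms are bilinear. For a $(k,l)$-partition diagram $d_\pi$, let $E_\pi : (\mathbb{R}^n)^{\otimes k} \to (\mathbb{R}^n)^{\otimes l}$ be the linear map whose matrix in the standard bases has, for $I \in [n]^l$ and $J \in [n]^k$, the $(I,J)$ entry $1$ if the labelling of the top row by $I$ and of the bottom row by $J$ is constant on the blocks of $\pi$, and $0$ otherwise. Then there exists a functor $\Theta : \mathcal{P}(n) \to \mathcal{C}(S_n)$ with $\Theta(k) = ((\mathbb{R}^n)^{\otimes k}, \rho_k)$ for all $k \ge 0$ and $\Theta(d_\pi) = E_\pi$ for all $k, l \ge 0$ and all $(k,l)$-partition diagrams $d_\pi$, such that $\Theta$ is (i) strict $\mathbb{R}$-linear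 monoidal: $\Theta(X \otimes Y) = \Theta(X) \otimes \Theta(Y)$ for all objects, $\Theta(f \otimes g) = \Theta(f) \otimes \Theta(g)$ for all morphisms, $\Theta$ maps the unit object to the unit object, and $\Theta$ is $\mathbb{R}$-linear on each morphism space; and (ii) full: for all $k, l \ge 0$ the map $\mathrm{Hom}_{\mathcal{P}(n)}(k,l) \to \mathrm{Hom}_{\mathcal{C}(S_n)}(\Theta(k), \Theta(l))$ is surjective (equivalently, given the above, every $S_n$-equivariant linear map $(\mathbb{R}^n)^{\otimes k} \to (\mathbb{R}^n)^{\otimes l}$ is a linear combination of the $E_\pi$). -/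

import Mathlib

open scoped TensorProduct

noncomputable section

/-! ### Partition diagrams

A set partition of a set of vertices is given by its equivalence relation "being in the same
block", a `Setoid`. In `Setoid (T ⊕ B)`, `T` is the top row and `B` the bottom row. -/

namespace Diagram

/-- A `(k, l)`-partition diagram: a set partition of `l` top vertices and `k` bottom vertices. -/
abbrev PartitionDiagram (k l : ℕ) : Type := Setoid (Fin l ⊕ Fin k)

section Concat

variable {T M B A : Type}

/-- The three-row diagram that is obtained by putting `π₁` below `π₂`: the equivalence relation on
the vertices of the three rows that is generated by the blocks of `π₂` (top and middle row) and the
blocks of `π₁` (middle and bottom row). -/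
def concat (π₂ : Setoid (T ⊕ M)) (π₁ : Setoid (M ⊕ B)) : Setoid (T ⊕ (M ⊕ B)) :=
  Relation.EqvGen.setoid fun u v =>
    (∃ a b, π₂ a b ∧ u = Sum.map id Sum.inl a ∧ v = Sum.map id Sum.inl b) ∨
      (∃ a b, π₁ a b ∧ u = Sum.inr a ∧ v = Sum.inr b)

/-- The diagram `π₂ ∘ π₁`: the restriction of the three-row diagram to the top and bottom rows. -/
def vcomp (π₂ : Setoid (T ⊕ M)) (π₁ : Setoid (M ⊕ B)) : Setoid (T ⊕ B) :=
  (concat π₂ π₁).comap (Sum.map id Sum.inr)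

/-- The number `c(π₂, π₁)` of connected components of the three-row diagram that lie entirely in the
middle row. -/
def numRemoved (π₂ : Setoid (T ⊕ M)) (π₁ : Setoid (M ⊕ B)) : ℕ :=
  Nat.card {q : Quotient (concat π₂ π₁) //
    ∀ v : T ⊕ (M ⊕ B), Quotient.mk (concat π₂ π₁) v = q → ∃ j : M, v = Sum.inr (Sum.inl j)}

/-- The identity diagram: each top vertex is joined to the bottom vertex with the same label. -/
def idDiagram : Setoid (T ⊕ T) := Setoid.ker (Sum.elim id id)

/-- The disjoint union of two set partitions. -/
def disjUnion {V W : Type} (π : Setoid V) (τ : Setoid W) : Setoid (V ⊕ W) where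
  r := Sum.LiftRel π τ
  iseqv :=
    { refl := by rintro (a | b) <;> simp
      symm := by rintro (a | b) (c | d) <;> simp <;> apply Setoid.symm
      trans := by
        rintro (a | b) (c | d) (e | f) <;> simp <;> apply Setoid.trans }

end Concat

/-- Horizontal juxtaposition of diagrams, `π` to the left of `τ`: in both rows, the vertices of `π`
come first. -/
@[reducible] def hcomp {k l q m : ℕ} (π : PartitionDiagram k l) (τ : PartitionDiagram q m) :
    PartitionDiagram (k + q) (l + m) :=
  (disjUnion π τ).comap
    ((Equiv.sumCongr finSumFinEquiv.symm finSumFinEquiv.symm).trans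
      (Equiv.sumSumSumComm (Fin l) (Fin m) (Fin k) (Fin q)))

/-! Auxiliary 0-1 matrices, used to verify the axioms of a category below. -/

section Aux

variable {T M B A : Type}

open Classical in
/-- The 0-1 matrix that records which colourings of the two rows are constant on blocks. -/
def colourMatrix (A : Type) (π : Setoid (T ⊕ B)) : Matrix (T → A) (B → A) ℕ :=
  fun x y => if π ≤ Setoid.ker (Sum.elim x y) then 1 else 0

lemma concat_le_ker (π₂ : Setoid (T ⊕ M)) (π₁ : Setoid (M ⊕ B)) (x : T → A) (y : M → A)
    (z : B → A) : concat π₂ π₁ ≤ Setoid.ker (Sum.elim x (Sum.elim y z)) ↔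
      π₂ ≤ Setoid.ker (Sum.elim x y) ∧ π₁ ≤ Setoid.ker (Sum.elim y z) := by
  have key : ∀ a : T ⊕ M, Sum.elim x (Sum.elim y z) (Sum.map id Sum.inl a) = Sum.elim x y a := by
    rintro (a | a) <;> rfl
  constructor
  · intro h
    refine ⟨fun a b hab => ?_, fun a b hab => ?_⟩
    · have := h (Relation.EqvGen.rel _ _ (Or.inl ⟨a, b, hab, rfl, rfl⟩))
      rw [Setoid.ker_def, key, key] at this
      exact this
    · exact h (Relation.EqvGen.rel _ _ (Or.inr ⟨a, b, hab, rfl, rfl⟩))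
  · rintro ⟨h₂, h₁⟩
    refine Setoid.eqvGen_le ?_
    rintro u v (⟨a, b, hab, rfl, rfl⟩ | ⟨a, b, hab, rfl, rfl⟩)
    · rw [Setoid.ker_def, key, key]
      exact h₂ hab
    · exact h₁ hab

/-- The colourings of the middle row that are compatible with given colourings of the outer rows. -/
lemma card_middle [Finite M] [Finite T] [Finite B] [Fintype A] (π₂ : Setoid (T ⊕ M))
    (π₁ : Setoid (M ⊕ B)) (x : T → A) (z : B → A)
    (h : vcomp π₂ π₁ ≤ Setoid.ker (Sum.elim x z)) :
    Nat.card {y : M → A // concat π₂ π₁ ≤ Setoid.ker (Sum.elim x (Sum.elim y z))} =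
      Fintype.card A ^ numRemoved π₂ π₁ := by
  classical
  let s := concat π₂ π₁
  let p : Quotient s → Prop := fun q => ∃ o : T ⊕ B, Quotient.mk s (Sum.map id Sum.inr o) = q
  let x₀ : {q // p q} → A := fun q => Sum.elim x z q.2.choose
  have hx₀ : ∀ o : T ⊕ B, x₀ ⟨Quotient.mk s (Sum.map id Sum.inr o), o, rfl⟩ = Sum.elim x z o := by
    intro o
    have hp : p (Quotient.mk s (Sum.map id Sum.inr o)) := ⟨o, rfl⟩
    have hr : vcomp π₂ π₁ hp.choose o := Quotient.exact (s := s) hp.choose_spec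
    exact h hr
  have e₁ : {y : M → A // s ≤ Setoid.ker (Sum.elim x (Sum.elim y z))} ≃
      {F : Quotient s → A // F ∘ Subtype.val = x₀} :=
    { toFun := fun y => ⟨Quotient.lift (Sum.elim x (Sum.elim y.1 z)) (fun a b hab => y.2 hab), by
        funext q
        obtain ⟨_, o, rfl⟩ := q
        rw [hx₀]
        rcases o with o | o <;> rfl⟩
      invFun := fun F => ⟨fun j => F.1 (Quotient.mk s (Sum.inr (Sum.inl j))), by
        have hF : ∀ v, Sum.elim x (Sum.elim (fun j => F.1 (Quotient.mk s (Sum.inr (Sum.inl j)))) z) v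
            = F.1 (Quotient.mk s v) := by
          have hF' : ∀ o : T ⊕ B, F.1 (Quotient.mk s (Sum.map id Sum.inr o)) = Sum.elim x z o := by
            intro o
            rw [← hx₀]
            exact congrFun F.2 ⟨_, o, rfl⟩
          rintro (t | j | b)
          · exact (hF' (Sum.inl t)).symm
          · rfl
          · exact (hF' (Sum.inr b)).symm
        intro a b hab
        rw [Setoid.ker_def, hF, hF]
        exact congrArg F.1 (Quotient.sound hab)⟩
      left_inv := fun y => rfl
      right_inv := fun F => by
        apply Subtype.ext
        funext q
        obtain ⟨v, rfl⟩ := Quotient.exists_rep q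
        have hF' : ∀ o : T ⊕ B, F.1 (Quotient.mk s (Sum.map id Sum.inr o)) = Sum.elim x z o := by
          intro o
          rw [← hx₀]
          exact congrFun F.2 ⟨_, o, rfl⟩
        rcases v with t | j | b
        · exact (hF' (Sum.inl t)).symm
        · rfl
        · exact (hF' (Sum.inr b)).symm }
  have e₂ : {q // ¬ p q} ≃ {q : Quotient s //
      ∀ v : T ⊕ (M ⊕ B), Quotient.mk s v = q → ∃ j : M, v = Sum.inr (Sum.inl j)} := by
    refine Equiv.subtypeEquivRight fun q => ?_
    constructor
    · rintro hq (t | j | b) rfl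
      · exact (hq ⟨Sum.inl t, rfl⟩).elim
      · exact ⟨j, rfl⟩
      · exact (hq ⟨Sum.inr b, rfl⟩).elim
    · rintro hq ⟨o, rfl⟩
      obtain ⟨j, hj⟩ := hq _ rfl
      rcases o with o | o <;> simp at hj
  rw [numRemoved, ← Nat.card_congr e₂, Nat.card_congr (e₁.trans (Equiv.subtypePreimage p x₀)),
    Nat.card_fun, Nat.card_eq_fintype_card]

lemma colourMatrix_mul [Fintype T] [Fintype M] [Fintype B] [Fintype A] [DecidableEq M]
    (π₂ : Setoid (T ⊕ M)) (π₁ : Setoid (M ⊕ B)) :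
    colourMatrix A π₂ * colourMatrix A π₁ =
      Fintype.card A ^ numRemoved π₂ π₁ • colourMatrix A (vcomp π₂ π₁) := by
  classical
  ext x z
  rw [Matrix.mul_apply, Matrix.smul_apply]
  have h₁ : ∀ y : M → A, colourMatrix A π₂ x y * colourMatrix A π₁ y z =
      if concat π₂ π₁ ≤ Setoid.ker (Sum.elim x (Sum.elim y z)) then 1 else 0 := by
    intro y
    simp only [colourMatrix, concat_le_ker]
    by_cases h₂ : π₂ ≤ Setoid.ker (Sum.elim x y) <;> simp [h₂]
  rw [Finset.sum_congr rfl fun y _ => h₁ y]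
  by_cases h : vcomp π₂ π₁ ≤ Setoid.ker (Sum.elim x z)
  · rw [← card_middle π₂ π₁ x z h]
    simp [colourMatrix, h, Nat.card_eq_fintype_card, Fintype.card_subtype]
  · have h₂ : ∀ y : M → A, ¬ concat π₂ π₁ ≤ Setoid.ker (Sum.elim x (Sum.elim y z)) := by
      intro y hy
      apply h
      intro a b hab
      have := hy hab
      rw [Setoid.ker_def] at this ⊢
      rcases a with a | a <;> rcases b with b | b <;> exact this
    simp [colourMatrix, h, h₂]

/-- Diagrams, with their multiplicities, are determined by their matrices over two colours. -/
lemma colourMatrix_cancel {c c' : ℕ} {π π' : Setoid (T ⊕ B)}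
    (h : Fintype.card Bool ^ c • colourMatrix Bool π =
      Fintype.card Bool ^ c' • colourMatrix Bool π') : c = c' ∧ π = π' := by
  classical
  have hc : c = c' := by
    have := congrFun (congrFun h fun _ => true) fun _ => true
    have h₁ : ∀ σ : Setoid (T ⊕ B),
        σ ≤ Setoid.ker (Sum.elim (fun _ : T => true) (fun _ : B => true)) := by
      intro σ a b _
      rw [Setoid.ker_def]
      rcases a with a | a <;> rcases b with b | b <;> rfl
    simp only [Matrix.smul_apply, colourMatrix, h₁, if_true, smul_eq_mul, mul_one,
      Fintype.card_bool] at this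
    exact Nat.pow_right_injective le_rfl this
  subst hc
  refine ⟨rfl, ?_⟩
  have h₂ : ∀ w : T ⊕ B → Bool, π ≤ Setoid.ker w ↔ π' ≤ Setoid.ker w := by
    intro w
    have := congrFun (congrFun h (w ∘ Sum.inl)) (w ∘ Sum.inr)
    simp only [Matrix.smul_apply, colourMatrix, Sum.elim_comp_inl_inr] at this
    have hne : (0 : ℕ) ≠ 2 ^ c := by positivity
    by_cases h₃ : π ≤ Setoid.ker w <;> by_cases h₄ : π' ≤ Setoid.ker w <;> simp_all
  have h₅ : ∀ σ σ' : Setoid (T ⊕ B),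
      (∀ w : T ⊕ B → Bool, σ ≤ Setoid.ker w ↔ σ' ≤ Setoid.ker w) → σ' ≤ σ := by
    intro σ σ' hσ a b hab
    have h₆ : σ ≤ Setoid.ker (fun v => decide (σ a v)) := by
      intro u v huv
      rw [Setoid.ker_def, decide_eq_decide]
      exact ⟨fun hu => σ.trans hu huv, fun hv => σ.trans hv (σ.symm huv)⟩
    have h₇ := (hσ _).1 h₆ hab
    rw [Setoid.ker_def, decide_eq_decide] at h₇
    exact h₇.1 (σ.refl a)
  exact le_antisymm (h₅ _ _ fun w => (h₂ w).symm) (h₅ _ _ h₂)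

lemma colourMatrix_inj {π π' : Setoid (T ⊕ B)} (h : colourMatrix Bool π = colourMatrix Bool π') :
    π = π' :=
  (colourMatrix_cancel (c := 0) (c' := 0) (by rw [h])).2

lemma colourMatrix_id [Fintype T] [DecidableEq T] [DecidableEq A] :
    colourMatrix A (idDiagram : Setoid (T ⊕ T)) = 1 := by
  classical
  ext x y
  rw [Matrix.one_apply, colourMatrix]
  congr 1
  refine propext ⟨fun h => funext fun t => ?_, ?_⟩
  · exact h (show idDiagram (Sum.inl t) (Sum.inr t) from rfl)
  · rintro rfl (a | a) (b | b) hab <;> cases hab <;> rfl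

lemma vcomp_assoc {D : Type} [Fintype T] [Fintype M] [Fintype B] [Fintype D]
    (π₃ : Setoid (D ⊕ T)) (π₂ : Setoid (T ⊕ M)) (π₁ : Setoid (M ⊕ B)) :
    numRemoved π₂ π₁ + numRemoved π₃ (vcomp π₂ π₁) =
        numRemoved π₃ π₂ + numRemoved (vcomp π₃ π₂) π₁ ∧
      vcomp π₃ (vcomp π₂ π₁) = vcomp (vcomp π₃ π₂) π₁ := by
  classical
  apply colourMatrix_cancel
  have := Matrix.mul_assoc (colourMatrix Bool π₃) (colourMatrix Bool π₂) (colourMatrix Bool π₁)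
  simp only [colourMatrix_mul, Matrix.smul_mul, Matrix.mul_smul, smul_smul, ← pow_add] at this
  exact this.symm

lemma id_vcomp [Fintype T] [Fintype B] (π : Setoid (T ⊕ B)) :
    numRemoved idDiagram π = 0 ∧ vcomp idDiagram π = π := by
  classical
  apply colourMatrix_cancel
  rw [← colourMatrix_mul, colourMatrix_id, Matrix.one_mul, pow_zero, one_smul]

lemma vcomp_id [Fintype T] [Fintype B] (π : Setoid (T ⊕ B)) :
    numRemoved π idDiagram = 0 ∧ vcomp π idDiagram = π := by
  classical
  apply colourMatrix_cancel
  rw [← colourMatrix_mul, colourMatrix_id, Matrix.mul_one, pow_zero, one_smul]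

lemma colourMatrix_hcomp {k l q m : ℕ} (π : PartitionDiagram k l) (τ : PartitionDiagram q m)
    (x : Fin l → A) (x' : Fin m → A) (y : Fin k → A) (y' : Fin q → A) :
    colourMatrix A (hcomp π τ) (Fin.append x x') (Fin.append y y') =
      colourMatrix A π x y * colourMatrix A τ x' y' := by
  classical
  have key : hcomp π τ ≤ Setoid.ker (Sum.elim (Fin.append x x') (Fin.append y y')) ↔
      π ≤ Setoid.ker (Sum.elim x y) ∧ τ ≤ Setoid.ker (Sum.elim x' y') := by
    let e := (Equiv.sumCongr finSumFinEquiv.symm finSumFinEquiv.symm).trans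
      (Equiv.sumSumSumComm (Fin l) (Fin m) (Fin k) (Fin q))
    have he : ∀ v, Sum.elim (Fin.append x x') (Fin.append y y') (e.symm v) =
        Sum.elim (Sum.elim x y) (Sum.elim x' y') v := by
      rintro ((a | a) | (a | a)) <;> simp [e]
    have h₁ : hcomp π τ ≤ Setoid.ker (Sum.elim (Fin.append x x') (Fin.append y y')) ↔
        disjUnion π τ ≤ Setoid.ker (Sum.elim (Sum.elim x y) (Sum.elim x' y')) := by
      constructor
      · intro h a b hab
        have h₂ : hcomp π τ (e.symm a) (e.symm b) := by
          change disjUnion π τ (e (e.symm a)) (e (e.symm b))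
          simpa using hab
        have h₃ := h h₂
        rw [Setoid.ker_def, he, he] at h₃
        exact h₃
      · intro h a b hab
        have h₃ := h (show disjUnion π τ (e a) (e b) from hab)
        rw [Setoid.ker_def, ← he, ← he] at h₃
        simpa using h₃
    rw [h₁]
    constructor
    · intro h
      exact ⟨fun a b hab => h (show disjUnion π τ (Sum.inl a) (Sum.inl b) from Sum.LiftRel.inl hab),
        fun a b hab => h (show disjUnion π τ (Sum.inr a) (Sum.inr b) from Sum.LiftRel.inr hab)⟩
    · rintro ⟨h, h'⟩ a b hab
      cases hab with
      | inl hab => exact h hab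
      | inr hab => exact h' hab
  simp only [colourMatrix, key]
  by_cases h₂ : π ≤ Setoid.ker (Sum.elim x y) <;> simp [h₂]

lemma hcomp_ext {k l q m : ℕ} {σ σ' : PartitionDiagram (k + q) (l + m)} {c c' : ℕ}
    (h : ∀ (x : Fin l → Bool) (x' : Fin m → Bool) (y : Fin k → Bool) (y' : Fin q → Bool),
      Fintype.card Bool ^ c * colourMatrix Bool σ (Fin.append x x') (Fin.append y y') =
        Fintype.card Bool ^ c' * colourMatrix Bool σ' (Fin.append x x') (Fin.append y y')) :
    c = c' ∧ σ = σ' := by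
  apply colourMatrix_cancel
  ext u v
  have := h (fun i => u (Fin.castAdd m i)) (fun i => u (Fin.natAdd l i))
    (fun i => v (Fin.castAdd q i)) (fun i => v (Fin.natAdd k i))
  rw [Fin.append_castAdd_natAdd, Fin.append_castAdd_natAdd] at this
  exact this

lemma hcomp_id (k l : ℕ) :
    hcomp (idDiagram : PartitionDiagram k k) (idDiagram : PartitionDiagram l l) = idDiagram := by
  refine (hcomp_ext (c := 0) (c' := 0) fun x x' y y' => ?_).2
  rw [colourMatrix_hcomp, colourMatrix_id, colourMatrix_id, colourMatrix_id]
  have : Fin.append x x' = Fin.append y y' ↔ x = y ∧ x' = y' := by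
    rw [← (Fin.appendEquiv k l).injective.eq_iff.trans Prod.mk_inj]
    rfl
  simp only [Matrix.one_apply, this]
  by_cases h : x = y <;> simp [h]

lemma hcomp_vcomp {k l m k' l' m' : ℕ} (π₂ : PartitionDiagram l m) (π₁ : PartitionDiagram k l)
    (τ₂ : PartitionDiagram l' m') (τ₁ : PartitionDiagram k' l') :
    numRemoved π₂ π₁ + numRemoved τ₂ τ₁ = numRemoved (hcomp π₂ τ₂) (hcomp π₁ τ₁) ∧
      hcomp (vcomp π₂ π₁) (vcomp τ₂ τ₁) = vcomp (hcomp π₂ τ₂) (hcomp π₁ τ₁) := by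
  refine hcomp_ext fun x x' y y' => ?_
  have h₁ := congrFun (congrFun (colourMatrix_mul (A := Bool) π₂ π₁) x) y
  have h₂ := congrFun (congrFun (colourMatrix_mul (A := Bool) τ₂ τ₁) x') y'
  have h₃ := congrFun (congrFun (colourMatrix_mul (A := Bool) (hcomp π₂ τ₂) (hcomp π₁ τ₁))
    (Fin.append x x')) (Fin.append y y')
  rw [Matrix.smul_apply, smul_eq_mul] at h₁ h₂ h₃
  rw [← h₃, colourMatrix_hcomp, pow_add, mul_mul_mul_comm, ← h₁, ← h₂, Matrix.mul_apply,
    Matrix.mul_apply, Matrix.mul_apply, Finset.sum_mul_sum, ← Finset.sum_product',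
    ← (Fin.appendEquiv l l').sum_comp]
  refine Finset.sum_congr rfl fun z _ => ?_
  change _ = colourMatrix Bool _ _ (Fin.append z.1 z.2) * colourMatrix Bool _ (Fin.append z.1 z.2) _
  rw [colourMatrix_hcomp, colourMatrix_hcomp, mul_mul_mul_comm]

/-- Relabelling of a diagram along equalities of the numbers of vertices. -/
@[reducible] def relabel {k l k' l' : ℕ} (hk : k = k') (hl : l = l') (π : PartitionDiagram k l) :
    PartitionDiagram k' l' :=
  π.comap (Sum.map (Fin.cast hl.symm) (Fin.cast hk.symm))

lemma colourMatrix_relabel {k l k' l' : ℕ} (hk : k = k') (hl : l = l') (π : PartitionDiagram k l)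
    (x : Fin l' → A) (y : Fin k' → A) :
    colourMatrix A (relabel hk hl π) x y = colourMatrix A π (x ∘ Fin.cast hl) (y ∘ Fin.cast hk) := by
  subst hk hl
  have : relabel rfl rfl π = π := by
    ext (a | a) (b | b) <;> rfl
  rw [this]
  rfl

lemma hcomp_assoc {k l k' l' k'' l'' : ℕ} (π : PartitionDiagram k l) (τ : PartitionDiagram k' l')
    (ω : PartitionDiagram k'' l'') :
    relabel (add_assoc k k' k'') (add_assoc l l' l'') (hcomp (hcomp π τ) ω) =
      hcomp π (hcomp τ ω) := by
  apply colourMatrix_inj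
  ext u v
  obtain ⟨⟨x, x'⟩, rfl⟩ := (Fin.appendEquiv l (l' + l'')).surjective u
  obtain ⟨⟨x', x''⟩, rfl⟩ := (Fin.appendEquiv l' l'').surjective x'
  obtain ⟨⟨y, y'⟩, rfl⟩ := (Fin.appendEquiv k (k' + k'')).surjective v
  obtain ⟨⟨y', y''⟩, rfl⟩ := (Fin.appendEquiv k' k'').surjective y'
  change colourMatrix Bool _ (Fin.append x (Fin.append x' x'')) (Fin.append y (Fin.append y' y'')) =
    colourMatrix Bool _ (Fin.append x (Fin.append x' x'')) (Fin.append y (Fin.append y' y''))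
  rw [colourMatrix_relabel, ← Fin.append_assoc, ← Fin.append_assoc, colourMatrix_hcomp,
    colourMatrix_hcomp, colourMatrix_hcomp, colourMatrix_hcomp, mul_assoc]

lemma colourMatrix_empty (π : PartitionDiagram 0 0) (x y : Fin 0 → A) :
    colourMatrix A π x y = 1 := by
  have : π ≤ Setoid.ker (Sum.elim x y) := by
    rintro (a | a) <;> exact a.elim0
  simp [colourMatrix, this]

lemma empty_hcomp {k l : ℕ} (ε : PartitionDiagram 0 0) (π : PartitionDiagram k l) :
    relabel (zero_add k) (zero_add l) (hcomp ε π) = π := by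
  apply colourMatrix_inj
  ext u v
  have h : ∀ (j : ℕ) (w : Fin j → Bool),
      w ∘ Fin.cast (zero_add j) = Fin.append (Fin.elim0 : Fin 0 → Bool) w := by
    intro j w
    rw [Fin.elim0_append]
  rw [colourMatrix_relabel, h, h, colourMatrix_hcomp, colourMatrix_empty, one_mul]

lemma hcomp_empty {k l : ℕ} (ε : PartitionDiagram 0 0) (π : PartitionDiagram k l) :
    relabel (add_zero k) (add_zero l) (hcomp π ε) = π := by
  apply colourMatrix_inj
  ext u v
  have h : ∀ (j : ℕ) (w : Fin j → Bool),
      w ∘ Fin.cast (add_zero j) = Fin.append w (Fin.elim0 : Fin 0 → Bool) := by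
    intro j w
    rw [Fin.append_elim0]
  rw [colourMatrix_relabel, h, h, colourMatrix_hcomp, colourMatrix_empty, mul_one]

end Aux

end Diagram

open CategoryTheory Diagram

/-! ### Strict linear monoidal categories and functors -/

universe v v' u u' w

/-- A strict monoidal category: a category with a bifunctor `⊗` (on objects and on morphisms) and a
unit object, such that `⊗` is associative and unital on the nose, both on objects and on morphisms.
Equalities between morphisms whose sources and targets are only propositionally equal are written
with the transports `eqToHom` along the equalities of objects. -/
class StrictMonoidalCategory (C : Type u) [Category.{v} C] where
  tensorObj : C → C → C
  tensorUnit : C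
  tensorHom : ∀ {X Y X' Y' : C}, (X ⟶ Y) → (X' ⟶ Y') → (tensorObj X X' ⟶ tensorObj Y Y')
  tensorHom_id : ∀ X Y : C, tensorHom (𝟙 X) (𝟙 Y) = 𝟙 (tensorObj X Y)
  tensorHom_comp : ∀ {X Y Z X' Y' Z' : C} (f : X ⟶ Y) (g : Y ⟶ Z) (f' : X' ⟶ Y') (g' : Y' ⟶ Z'),
    tensorHom (f ≫ g) (f' ≫ g') = tensorHom f f' ≫ tensorHom g g'
  tensorObj_assoc : ∀ X Y Z : C, tensorObj (tensorObj X Y) Z = tensorObj X (tensorObj Y Z)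
  unit_tensorObj : ∀ X : C, tensorObj tensorUnit X = X
  tensorObj_unit : ∀ X : C, tensorObj X tensorUnit = X
  tensorHom_assoc : ∀ {X Y X' Y' X'' Y'' : C} (f : X ⟶ Y) (g : X' ⟶ Y') (h : X'' ⟶ Y''),
    tensorHom (tensorHom f g) h ≫ eqToHom (tensorObj_assoc Y Y' Y'') =
      eqToHom (tensorObj_assoc X X' X'') ≫ tensorHom f (tensorHom g h)
  unit_tensorHom : ∀ {X Y : C} (f : X ⟶ Y),
    tensorHom (𝟙 tensorUnit) f ≫ eqToHom (unit_tensorObj Y) = eqToHom (unit_tensorObj X) ≫ f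
  tensorHom_unit : ∀ {X Y : C} (f : X ⟶ Y),
    tensorHom f (𝟙 tensorUnit) ≫ eqToHom (tensorObj_unit Y) = eqToHom (tensorObj_unit X) ≫ f

/-- A strict `R`-linear monoidal category: a category that is strict monoidal and `R`-linear, such
that the bifunctor `⊗` is `R`-bilinear on morphisms. -/
class StrictLinearMonoidalCategory (R : Type w) [Semiring R] (C : Type u) [Category.{v} C]
    [Preadditive C] [Linear R C] extends StrictMonoidalCategory C where
  add_tensorHom : ∀ {X Y X' Y' : C} (f f' : X ⟶ Y) (g : X' ⟶ Y'),
    tensorHom (f + f') g = tensorHom f g + tensorHom f' g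
  tensorHom_add : ∀ {X Y X' Y' : C} (f : X ⟶ Y) (g g' : X' ⟶ Y'),
    tensorHom f (g + g') = tensorHom f g + tensorHom f g'
  smul_tensorHom : ∀ {X Y X' Y' : C} (r : R) (f : X ⟶ Y) (g : X' ⟶ Y'),
    tensorHom (r • f) g = r • tensorHom f g
  tensorHom_smul : ∀ {X Y X' Y' : C} (r : R) (f : X ⟶ Y) (g : X' ⟶ Y'),
    tensorHom f (r • g) = r • tensorHom f g

/-- A functor `F` between strict `R`-linear monoidal categories is strict `R`-linear monoidal if
`F (X ⊗ Y) = F X ⊗ F Y`, `F 𝟙 = 𝟙`, `F (f ⊗ g) = F f ⊗ F g`, and `F` is `R`-linear on morphism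
spaces. -/
structure IsStrictLinearMonoidalFunctor (R : Type w) [Semiring R]
    {C : Type u} [Category.{v} C] [Preadditive C] [Linear R C] [StrictLinearMonoidalCategory R C]
    {D : Type u'} [Category.{v'} D] [Preadditive D] [Linear R D] [StrictLinearMonoidalCategory R D]
    (F : C ⥤ D) : Prop where
  map_tensorObj : ∀ X Y : C, F.obj (StrictMonoidalCategory.tensorObj X Y) =
    StrictMonoidalCategory.tensorObj (F.obj X) (F.obj Y)
  map_tensorHom : ∀ {X Y X' Y' : C} (f : X ⟶ Y) (g : X' ⟶ Y'),
    F.map (StrictMonoidalCategory.tensorHom f g) ≫ eqToHom (map_tensorObj Y Y') =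
      eqToHom (map_tensorObj X X') ≫ StrictMonoidalCategory.tensorHom (F.map f) (F.map g)
  map_tensorUnit : F.obj StrictMonoidalCategory.tensorUnit = StrictMonoidalCategory.tensorUnit
  map_add : ∀ {X Y : C} (f g : X ⟶ Y), F.map (f + g) = F.map f + F.map g
  map_smul : ∀ {X Y : C} (r : R) (f : X ⟶ Y), F.map (r • f) = r • F.map f

/-! ### The partition category -/

/-- The partition space `P_k^l`: the real vector space with basis the `(k, l)`-partition diagrams. -/
abbrev PartitionSpace (k l : ℕ) : Type := PartitionDiagram k l →₀ ℝ

/-- The basis vector `d_π` of the partition space. -/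
def diagramVector {k l : ℕ} (π : PartitionDiagram k l) : PartitionSpace k l := Finsupp.single π 1

/-- Composition with parameter `n`: the bilinear map with
`d_{π₂} • d_{π₁} = n ^ c(π₂, π₁) d_{π₂ ∘ π₁}`. -/
def diagramComp (n : ℕ) {k l m : ℕ} :
    PartitionSpace l m →ₗ[ℝ] PartitionSpace k l →ₗ[ℝ] PartitionSpace k m :=
  Finsupp.linearCombination ℝ fun π₂ => Finsupp.linearCombination ℝ fun π₁ =>
    (n : ℝ) ^ numRemoved π₂ π₁ • diagramVector (vcomp π₂ π₁)

/-- The tensor product: the bilinear map that juxtaposes diagrams horizontally. -/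
def diagramTensor {k l q m : ℕ} :
    PartitionSpace k l →ₗ[ℝ] PartitionSpace q m →ₗ[ℝ] PartitionSpace (k + q) (l + m) :=
  Finsupp.linearCombination ℝ fun π => Finsupp.linearCombination ℝ fun τ =>
    diagramVector (hcomp π τ)

lemma diagramComp_diagramVector (n : ℕ) {k l m : ℕ} (π₂ : PartitionDiagram l m)
    (π₁ : PartitionDiagram k l) : diagramComp n (diagramVector π₂) (diagramVector π₁) =
      (n : ℝ) ^ numRemoved π₂ π₁ • diagramVector (vcomp π₂ π₁) := by
  simp [diagramComp, diagramVector]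

lemma diagramTensor_diagramVector {k l q m : ℕ} (π : PartitionDiagram k l)
    (τ : PartitionDiagram q m) :
    diagramTensor (diagramVector π) (diagramVector τ) = diagramVector (hcomp π τ) := by
  simp [diagramTensor, diagramVector]

lemma PartitionSpace.induction {k l : ℕ} {P : PartitionSpace k l → Prop} (f : PartitionSpace k l)
    (h₀ : ∀ π, P (diagramVector π)) (h₁ : ∀ f g, P f → P g → P (f + g))
    (h₂ : ∀ (r : ℝ) f, P f → P (r • f)) : P f := by
  have hs : ∀ π r, P (Finsupp.single π r) := fun π r => by
    have := h₂ r _ (h₀ π)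
    rwa [diagramVector, Finsupp.smul_single, smul_eq_mul, mul_one] at this
  induction f using Finsupp.induction_linear with
  | zero => simpa using hs ⊥ 0
  | add f g hf hg => exact h₁ f g hf hg
  | single π r => exact hs π r

/-- The partition category `𝒫(n)`: its objects are the non-negative integers. -/
structure PartitionCategory (n : ℕ) where
  of ::
  rank : ℕ

namespace PartitionCategory

variable {n : ℕ}

/-- Morphisms `k ⟶ l` are the elements of the partition space `P_k^l`, and composition is the
composition of partition diagrams with parameter `n`. -/
instance : Category (PartitionCategory n) where
  Hom X Y := PartitionSpace X.rank Y.rank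
  id X := diagramVector idDiagram
  comp f g := diagramComp n g f
  id_comp {X Y} f := by
    induction f using PartitionSpace.induction with
    | h₀ π => rw [diagramComp_diagramVector, (vcomp_id π).1, (vcomp_id π).2, pow_zero, one_smul]
    | h₁ f g hf hg => rw [map_add, LinearMap.add_apply, hf, hg]
    | h₂ r f hf => rw [map_smul, LinearMap.smul_apply, hf]
  comp_id {X Y} f := by
    induction f using PartitionSpace.induction with
    | h₀ π => rw [diagramComp_diagramVector, (id_vcomp π).1, (id_vcomp π).2, pow_zero, one_smul]
    | h₁ f g hf hg => rw [map_add, hf, hg]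
    | h₂ r f hf => rw [map_smul, hf]
  assoc {W X Y Z} f g h := by
    induction f using PartitionSpace.induction with
    | h₁ f g hf hg => simp only [map_add, hf, hg]
    | h₂ r f hf => simp only [map_smul, hf]
    | h₀ π₁ =>
    induction g using PartitionSpace.induction with
    | h₁ f g hf hg => simp only [map_add, LinearMap.add_apply, hf, hg]
    | h₂ r f hf => simp only [map_smul, LinearMap.smul_apply, hf]
    | h₀ π₂ =>
    induction h using PartitionSpace.induction with
    | h₁ f g hf hg => simp only [map_add, LinearMap.add_apply, hf, hg]
    | h₂ r f hf => simp only [map_smul, LinearMap.smul_apply, hf]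
    | h₀ π₃ =>
    simp only [diagramComp_diagramVector, map_smul, LinearMap.smul_apply, smul_smul, ← pow_add]
    rw [(vcomp_assoc π₃ π₂ π₁).1, (vcomp_assoc π₃ π₂ π₁).2]

instance : Preadditive (PartitionCategory n) where
  homGroup X Y := inferInstanceAs (AddCommGroup (PartitionSpace X.rank Y.rank))
  add_comp X Y Z f f' g :=
    (diagramComp n (k := X.rank) (l := Y.rank) (m := Z.rank) g).map_add f f'
  comp_add X Y Z f g g' :=
    (diagramComp n (k := X.rank) (l := Y.rank) (m := Z.rank)).map_add₂ g g' f

instance : Linear ℝ (PartitionCategory n) where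
  homModule X Y := inferInstanceAs (Module ℝ (PartitionSpace X.rank Y.rank))
  smul_comp X Y Z r f g :=
    (diagramComp n (k := X.rank) (l := Y.rank) (m := Z.rank) g).map_smul r f
  comp_smul X Y Z f r g :=
    (diagramComp n (k := X.rank) (l := Y.rank) (m := Z.rank)).map_smul₂ r g f

/-- The diagram `d_π` as a morphism of the partition category. -/
def diagram {k l : ℕ} (π : PartitionDiagram k l) :
    (of k : PartitionCategory n) ⟶ of l :=
  diagramVector π

lemma diagram_comp_eqToHom {k l k' l' : ℕ} (hk : k = k') (hl : l = l')
    {π : PartitionDiagram k l} {π' : PartitionDiagram k' l'} (h : relabel hk hl π = π') :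
    (diagram π : (of k : PartitionCategory n) ⟶ of l) ≫ eqToHom (congrArg of hl) =
      eqToHom (congrArg of hk) ≫ diagram π' := by
  subst hk hl h
  have : relabel rfl rfl π = π := by
    ext (a | a) (b | b) <;> rfl
  simp [this]

lemma hom_induction {X Y : PartitionCategory n} {P : (X ⟶ Y) → Prop} (f : X ⟶ Y)
    (h₀ : ∀ π : PartitionDiagram X.rank Y.rank, P (diagram π))
    (h₁ : ∀ f g, P f → P g → P (f + g)) (h₂ : ∀ (r : ℝ) f, P f → P (r • f)) : P f :=
  PartitionSpace.induction (P := P) f h₀ h₁ h₂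

/-- The tensor product of morphisms, as a bilinear map. -/
def tensor {X Y X' Y' : PartitionCategory n} :
    (X ⟶ Y) →ₗ[ℝ] (X' ⟶ Y') →ₗ[ℝ] ((of (X.rank + X'.rank) : PartitionCategory n) ⟶
      of (Y.rank + Y'.rank)) :=
  diagramTensor (k := X.rank) (l := Y.rank) (q := X'.rank) (m := Y'.rank)

lemma tensor_diagram {k l q m : ℕ} (π : PartitionDiagram k l) (τ : PartitionDiagram q m) :
    tensor (diagram π : (of k : PartitionCategory n) ⟶ of l)
      (diagram τ : (of q : PartitionCategory n) ⟶ of m) = diagram (hcomp π τ) :=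
  diagramTensor_diagramVector π τ

lemma diagram_comp {k l m : ℕ} (π₁ : PartitionDiagram k l) (π₂ : PartitionDiagram l m) :
    (diagram π₁ : (of k : PartitionCategory n) ⟶ of l) ≫ diagram π₂ =
      (n : ℝ) ^ numRemoved π₂ π₁ • diagram (vcomp π₂ π₁) :=
  diagramComp_diagramVector n π₂ π₁

lemma tensor_comp_diagram {k l m k' l' m' : ℕ} (π₁ : PartitionDiagram k l)
    (π₂ : PartitionDiagram l m) (τ₁ : PartitionDiagram k' l') (τ₂ : PartitionDiagram l' m') :
    tensor ((diagram π₁ : (of k : PartitionCategory n) ⟶ of l) ≫ diagram π₂)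
        ((diagram τ₁ : (of k' : PartitionCategory n) ⟶ of l') ≫ diagram τ₂) =
      tensor (diagram π₁) (diagram τ₁) ≫ tensor (diagram π₂) (diagram τ₂) := by
  have h := hcomp_vcomp π₂ π₁ τ₂ τ₁
  have e := diagram_comp (n := n) (hcomp π₁ τ₁) (hcomp π₂ τ₂)
  rw [← h.1, ← h.2, pow_add] at e
  rw [tensor_diagram, tensor_diagram]
  refine Eq.trans ?_ e.symm
  rw [diagram_comp, diagram_comp, map_smul, LinearMap.map_smul₂, smul_smul, tensor_diagram,
    mul_comm]

lemma tensor_assoc_diagram {k l k' l' k'' l'' : ℕ} (π : PartitionDiagram k l)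
    (τ : PartitionDiagram k' l') (ω : PartitionDiagram k'' l'') :
    tensor (tensor (diagram π : (of k : PartitionCategory n) ⟶ of l)
        (diagram τ : (of k' : PartitionCategory n) ⟶ of l'))
        (diagram ω : (of k'' : PartitionCategory n) ⟶ of l'') ≫
          eqToHom (congrArg of (add_assoc l l' l'')) =
      eqToHom (congrArg of (add_assoc k k' k'')) ≫
        tensor (diagram π) (tensor (diagram τ) (diagram ω)) := by
  rw [tensor_diagram, tensor_diagram, tensor_diagram]
  refine Eq.trans ?_ (congrArg (eqToHom _ ≫ ·) (tensor_diagram (n := n) π (hcomp τ ω))).symm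
  exact diagram_comp_eqToHom _ _ (hcomp_assoc π τ ω)

lemma unit_tensor_diagram {k l : ℕ} (π : PartitionDiagram k l) :
    tensor (𝟙 (of 0 : PartitionCategory n)) (diagram π : (of k : PartitionCategory n) ⟶ of l) ≫
        eqToHom (congrArg of (zero_add l)) =
      eqToHom (congrArg of (zero_add k)) ≫ diagram π := by
  refine (congrArg (· ≫ eqToHom _) (tensor_diagram (n := n) idDiagram π)).trans ?_
  exact diagram_comp_eqToHom _ _ (empty_hcomp _ π)

lemma tensor_unit_diagram {k l : ℕ} (π : PartitionDiagram k l) :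
    tensor (diagram π : (of k : PartitionCategory n) ⟶ of l) (𝟙 (of 0 : PartitionCategory n)) ≫
        eqToHom (congrArg of (add_zero l)) =
      eqToHom (congrArg of (add_zero k)) ≫ diagram π := by
  refine (congrArg (· ≫ eqToHom _) (tensor_diagram (n := n) π idDiagram)).trans ?_
  exact diagram_comp_eqToHom _ _ (hcomp_empty _ π)

instance : StrictLinearMonoidalCategory ℝ (PartitionCategory n) where
  tensorObj X Y := of (X.rank + Y.rank)
  tensorUnit := of 0
  tensorHom f g := tensor f g
  tensorHom_id X Y := (tensor_diagram _ _).trans (congrArg diagram (hcomp_id X.rank Y.rank))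
  tensorHom_comp {X Y Z X' Y' Z'} f g f' g' := by
    induction f using hom_induction with
    | h₁ a b ha hb =>
      simp only [Preadditive.add_comp, map_add, LinearMap.add_apply, ha, hb]
    | h₂ r a ha => simp only [Linear.smul_comp, map_smul, LinearMap.smul_apply, ha]
    | h₀ π₁ =>
    induction g using hom_induction with
    | h₁ a b ha hb =>
      simp only [Preadditive.comp_add, map_add, LinearMap.add_apply, ha, hb]
    | h₂ r a ha => simp only [Linear.comp_smul, map_smul, LinearMap.smul_apply, ha]
    | h₀ π₂ =>
    induction f' using hom_induction with
    | h₁ a b ha hb => simp only [Preadditive.add_comp, map_add, ha, hb]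
    | h₂ r a ha => simp only [Linear.smul_comp, map_smul, ha]
    | h₀ τ₁ =>
    induction g' using hom_induction with
    | h₁ a b ha hb => simp only [Preadditive.comp_add, map_add, ha, hb]
    | h₂ r a ha => simp only [Linear.comp_smul, map_smul, ha]
    | h₀ τ₂ =>
    exact tensor_comp_diagram π₁ π₂ τ₁ τ₂
  tensorObj_assoc X Y Z := congrArg of (add_assoc _ _ _)
  unit_tensorObj X := congrArg of (zero_add _)
  tensorObj_unit X := congrArg of (add_zero _)
  tensorHom_assoc f g h := by
    induction f using hom_induction with
    | h₁ a b ha hb => simp only [Preadditive.add_comp, Preadditive.comp_add, map_add,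
        LinearMap.add_apply, ha, hb]
    | h₂ r a ha => simp only [Linear.smul_comp, Linear.comp_smul, map_smul, LinearMap.smul_apply, ha]
    | h₀ π =>
    induction g using hom_induction with
    | h₁ a b ha hb => simp only [Preadditive.add_comp, Preadditive.comp_add, map_add,
        LinearMap.add_apply, ha, hb]
    | h₂ r a ha => simp only [Linear.smul_comp, Linear.comp_smul, map_smul, LinearMap.smul_apply, ha]
    | h₀ τ =>
    induction h using hom_induction with
    | h₁ a b ha hb => simp only [Preadditive.add_comp, Preadditive.comp_add, map_add, ha, hb]
    | h₂ r a ha => simp only [Linear.smul_comp, Linear.comp_smul, map_smul, ha]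
    | h₀ ω =>
    exact tensor_assoc_diagram π τ ω
  unit_tensorHom f := by
    induction f using hom_induction with
    | h₁ a b ha hb => simp only [Preadditive.add_comp, Preadditive.comp_add, map_add, ha, hb]
    | h₂ r a ha => simp only [Linear.smul_comp, Linear.comp_smul, map_smul, ha]
    | h₀ π =>
    exact unit_tensor_diagram π
  tensorHom_unit f := by
    induction f using hom_induction with
    | h₁ a b ha hb => simp only [Preadditive.add_comp, Preadditive.comp_add, map_add,
        LinearMap.add_apply, ha, hb]
    | h₂ r a ha => simp only [Linear.smul_comp, Linear.comp_smul, map_smul, LinearMap.smul_apply, ha]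
    | h₀ π =>
    exact tensor_unit_diagram π
  add_tensorHom f f' g := LinearMap.map_add₂ tensor f f' g
  tensorHom_add f g g' := map_add (tensor f) g g'
  smul_tensorHom r f g := LinearMap.map_smul₂ tensor r f g
  tensorHom_smul r f g := map_smul (tensor f) r g

end PartitionCategory

/-! ### Tensor powers of `ℝⁿ` and `S_n`-equivariant linear maps -/

/-- The representation of `S_n` on `ℝⁿ` by permutation of the standard basis, `σ e_i = e_{σ i}`:
in coordinates, `(σ v)_i = v_{σ⁻¹ i}`. -/
def permRep (n : ℕ) : Representation ℝ (Equiv.Perm (Fin n)) (Fin n → ℝ) where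
  toFun σ := LinearMap.funLeft ℝ ℝ ⇑(σ⁻¹)
  map_one' := rfl
  map_mul' σ τ := by ext v i; simp [LinearMap.funLeft]

/-- The representation `ρ_k` of `S_n` on the `k`-th tensor power of `ℝⁿ`:
`σ (v₁ ⊗ ⋯ ⊗ v_k) = σ v₁ ⊗ ⋯ ⊗ σ v_k`. -/
def tensorRep (n k : ℕ) :
    Representation ℝ (Equiv.Perm (Fin n)) (⨂[ℝ]^k (Fin n → ℝ)) where
  toFun σ := PiTensorProduct.map fun _ => permRep n σ
  map_one' := by simp only [map_one]; exact PiTensorProduct.map_one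
  map_mul' σ τ := by simp only [map_mul]; exact PiTensorProduct.map_mul _ _

lemma tensorPower_hom_ext {k q : ℕ} {V W : Type} [AddCommGroup V] [Module ℝ V] [AddCommGroup W]
    [Module ℝ W] {L L' : ⨂[ℝ]^(k + q) V →ₗ[ℝ] W}
    (h : ∀ (a : ⨂[ℝ]^k V) (b : ⨂[ℝ]^q V),
      L (TensorPower.mulEquiv (a ⊗ₜ b)) = L' (TensorPower.mulEquiv (a ⊗ₜ b))) : L = L' := by
  have : L ∘ₗ (TensorPower.mulEquiv (R := ℝ) (M := V) (n := k) (m := q)).toLinearMap =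
      L' ∘ₗ TensorPower.mulEquiv.toLinearMap := TensorProduct.ext' h
  ext1
  ext v
  have h₂ := LinearMap.congr_fun this (TensorPower.mulEquiv.symm (PiTensorProduct.tprod ℝ v))
  simpa using h₂

lemma tensorRep_mulEquiv {n k q : ℕ} (σ : Equiv.Perm (Fin n))
    (a : ⨂[ℝ]^k (Fin n → ℝ)) (b : ⨂[ℝ]^q (Fin n → ℝ)) :
    tensorRep n (k + q) σ (TensorPower.mulEquiv (a ⊗ₜ b)) =
      TensorPower.mulEquiv (tensorRep n k σ a ⊗ₜ tensorRep n q σ b) := by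
  have hc : ∀ (j : ℕ) (v : Fin j → Fin n → ℝ),
      tensorRep n j σ (PiTensorProduct.tprod ℝ v) =
        PiTensorProduct.tprod ℝ fun i => permRep n σ (v i) :=
    fun j v => PiTensorProduct.map_tprod _ _
  induction a using PiTensorProduct.induction_on with
  | add a a' ha ha' => simp only [TensorProduct.add_tmul, map_add, ha, ha']
  | smul_tprod r v =>
    induction b using PiTensorProduct.induction_on with
    | add b b' hb hb' => simp only [TensorProduct.tmul_add, map_add, hb, hb']
    | smul_tprod s w =>
      simp only [TensorProduct.tmul_smul, ← TensorProduct.smul_tmul', map_smul, hc,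
        ← TensorPower.gMul_def, TensorPower.tprod_mul_tprod]
      congr 3
      funext i
      refine Fin.addCases (fun j => ?_) (fun j => ?_) i <;> simp

/-- The category `𝒞(S_n)`: the object `of k` is the pair of the `k`-th tensor power of `ℝⁿ` and the
representation `ρ_k` of `S_n` on it. -/
structure TensorPowerCategory (n : ℕ) where
  of ::
  power : ℕ

namespace TensorPowerCategory

variable {n : ℕ}

/-- Morphisms are the `S_n`-equivariant linear maps, composed as linear maps. -/
instance : Category (TensorPowerCategory n) where
  Hom X Y := (tensorRep n X.power).IntertwiningMap (tensorRep n Y.power)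
  id X := Representation.IntertwiningMap.id _
  comp f g := Representation.IntertwiningMap.comp g f

/-- The underlying linear map of a morphism. -/
def toLinearMap {X Y : TensorPowerCategory n} (f : X ⟶ Y) :
    ⨂[ℝ]^X.power (Fin n → ℝ) →ₗ[ℝ] ⨂[ℝ]^Y.power (Fin n → ℝ) :=
  Representation.IntertwiningMap.toLinearMap f

lemma hom_ext {X Y : TensorPowerCategory n} {f g : X ⟶ Y} (h : toLinearMap f = toLinearMap g) :
    f = g :=
  Representation.IntertwiningMap.ext h

instance : Preadditive (TensorPowerCategory n) where
  homGroup X Y := inferInstanceAs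
    (AddCommGroup ((tensorRep n X.power).IntertwiningMap (tensorRep n Y.power)))
  add_comp _ _ _ _ _ _ := hom_ext (LinearMap.comp_add _ _ _)
  comp_add _ _ _ _ _ _ := hom_ext (LinearMap.add_comp _ _ _)

instance : Linear ℝ (TensorPowerCategory n) where
  homModule X Y := inferInstanceAs
    (Module ℝ ((tensorRep n X.power).IntertwiningMap (tensorRep n Y.power)))
  smul_comp _ _ _ _ _ _ := hom_ext (LinearMap.comp_smul _ _ _)
  comp_smul _ _ _ _ _ _ := hom_ext (LinearMap.smul_comp _ _ _)

/-- The tensor product of two linear maps between tensor powers, under the canonical identifications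
`V^{⊗k} ⊗ V^{⊗q} = V^{⊗(k+q)}`. -/
def tensorMap {k l q m : ℕ} (f : ⨂[ℝ]^k (Fin n → ℝ) →ₗ[ℝ] ⨂[ℝ]^l (Fin n → ℝ))
    (g : ⨂[ℝ]^q (Fin n → ℝ) →ₗ[ℝ] ⨂[ℝ]^m (Fin n → ℝ)) :
    ⨂[ℝ]^(k + q) (Fin n → ℝ) →ₗ[ℝ] ⨂[ℝ]^(l + m) (Fin n → ℝ) :=
  TensorPower.mulEquiv.toLinearMap ∘ₗ TensorProduct.map f g ∘ₗ
    TensorPower.mulEquiv.symm.toLinearMap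

lemma tensorMap_mulEquiv {k l q m : ℕ} (f : ⨂[ℝ]^k (Fin n → ℝ) →ₗ[ℝ] ⨂[ℝ]^l (Fin n → ℝ))
    (g : ⨂[ℝ]^q (Fin n → ℝ) →ₗ[ℝ] ⨂[ℝ]^m (Fin n → ℝ)) (a : ⨂[ℝ]^k (Fin n → ℝ))
    (b : ⨂[ℝ]^q (Fin n → ℝ)) :
    tensorMap f g (TensorPower.mulEquiv (a ⊗ₜ b)) = TensorPower.mulEquiv (f a ⊗ₜ g b) := by
  simp [tensorMap]

/-- The tensor product of two equivariant linear maps. -/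
def tensor {X Y X' Y' : TensorPowerCategory n} (f : X ⟶ Y) (g : X' ⟶ Y') :
    (of (X.power + X'.power) : TensorPowerCategory n) ⟶ of (Y.power + Y'.power) where
  toLinearMap := tensorMap (toLinearMap f) (toLinearMap g)
  isIntertwining' σ := by
    refine tensorPower_hom_ext fun a b => ?_
    have hf : toLinearMap f (tensorRep n _ σ a) = tensorRep n _ σ (toLinearMap f a) :=
      Representation.IntertwiningMap.isIntertwining _ _ f σ a
    have hg : toLinearMap g (tensorRep n _ σ b) = tensorRep n _ σ (toLinearMap g b) :=
      Representation.IntertwiningMap.isIntertwining _ _ g σ b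
    rw [LinearMap.comp_apply, LinearMap.comp_apply]
    erw [tensorRep_mulEquiv, tensorMap_mulEquiv, tensorMap_mulEquiv, tensorRep_mulEquiv]
    rw [hf, hg]

lemma toLinearMap_tensor {X Y X' Y' : TensorPowerCategory n} (f : X ⟶ Y) (g : X' ⟶ Y') :
    toLinearMap (tensor f g) = tensorMap (toLinearMap f) (toLinearMap g) := rfl

lemma toLinearMap_comp {X Y Z : TensorPowerCategory n} (f : X ⟶ Y) (g : Y ⟶ Z) :
    toLinearMap (f ≫ g) = toLinearMap g ∘ₗ toLinearMap f := rfl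

lemma toLinearMap_id (X : TensorPowerCategory n) :
    toLinearMap (𝟙 X) = LinearMap.id := rfl

lemma toLinearMap_eqToHom {k l : ℕ} (h : k = l) :
    toLinearMap (eqToHom (congrArg of h) : (of k : TensorPowerCategory n) ⟶ of l) =
      (TensorPower.cast ℝ (Fin n → ℝ) h).toLinearMap := by
  subst h
  simp [toLinearMap_id]

lemma toLinearMap_add {X Y : TensorPowerCategory n} (f g : X ⟶ Y) :
    toLinearMap (f + g) = toLinearMap f + toLinearMap g := rfl

lemma toLinearMap_smul {X Y : TensorPowerCategory n} (r : ℝ) (f : X ⟶ Y) :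
    toLinearMap (r • f) = r • toLinearMap f := rfl

lemma tensor_assoc {X Y X' Y' X'' Y'' : TensorPowerCategory n} (f : X ⟶ Y) (g : X' ⟶ Y')
    (h : X'' ⟶ Y'') :
    toLinearMap (tensor (tensor f g) h ≫
        eqToHom (congrArg of (add_assoc Y.power Y'.power Y''.power))) =
      toLinearMap (eqToHom (congrArg of (add_assoc X.power X'.power X''.power)) ≫
        tensor f (tensor g h)) := by
  refine tensorPower_hom_ext fun u c => ?_
  obtain ⟨t, rfl⟩ := TensorPower.mulEquiv.surjective u
  induction t using TensorProduct.induction_on with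
  | zero =>
    rw [LinearEquiv.map_zero, TensorProduct.zero_tmul, LinearEquiv.map_zero, LinearMap.map_zero,
      LinearMap.map_zero]
  | add t t' ht ht' =>
    rw [LinearEquiv.map_add, TensorProduct.add_tmul, LinearEquiv.map_add, LinearMap.map_add,
      LinearMap.map_add, ht, ht']
  | tmul a b =>
    rw [toLinearMap_comp, toLinearMap_comp, toLinearMap_eqToHom (add_assoc _ _ _),
      toLinearMap_eqToHom (add_assoc _ _ _), LinearMap.comp_apply, LinearMap.comp_apply]
    have h₁ := TensorPower.mul_assoc a b c
    have h₂ := TensorPower.mul_assoc (toLinearMap f a) (toLinearMap g b) (toLinearMap h c)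
    simp only [TensorPower.gMul_def] at h₁ h₂
    have e₁ : toLinearMap (tensor (tensor f g) h)
        (TensorPower.mulEquiv (TensorPower.mulEquiv (a ⊗ₜ b) ⊗ₜ c)) =
        TensorPower.mulEquiv (TensorPower.mulEquiv (toLinearMap f a ⊗ₜ toLinearMap g b) ⊗ₜ
          toLinearMap h c) :=
      (tensorMap_mulEquiv _ _ _ _).trans (congrArg (fun z => TensorPower.mulEquiv (z ⊗ₜ _))
        (tensorMap_mulEquiv _ _ _ _))
    have e₂ : toLinearMap (tensor f (tensor g h))
        (TensorPower.mulEquiv (a ⊗ₜ TensorPower.mulEquiv (b ⊗ₜ c))) =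
        TensorPower.mulEquiv (toLinearMap f a ⊗ₜ
          TensorPower.mulEquiv (toLinearMap g b ⊗ₜ toLinearMap h c)) :=
      (tensorMap_mulEquiv _ _ _ _).trans (congrArg (fun z => TensorPower.mulEquiv (_ ⊗ₜ z))
        (tensorMap_mulEquiv _ _ _ _))
    refine (congrArg _ e₁).trans (h₂.trans (e₂.symm.trans (congrArg _ h₁.symm)))

lemma unit_tensor {X Y : TensorPowerCategory n} (f : X ⟶ Y) :
    toLinearMap (tensor (𝟙 (of 0 : TensorPowerCategory n)) f ≫
        eqToHom (congrArg of (zero_add Y.power))) =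
      toLinearMap (eqToHom (congrArg of (zero_add X.power)) ≫ f) := by
  refine tensorPower_hom_ext fun u a => ?_
  obtain ⟨r, rfl⟩ := TensorPower.algebraMap₀.surjective u
  rw [toLinearMap_comp, toLinearMap_comp, toLinearMap_eqToHom (zero_add _),
    toLinearMap_eqToHom (zero_add _), LinearMap.comp_apply, LinearMap.comp_apply]
  refine (congrArg _ (tensorMap_mulEquiv _ _ _ _)).trans
    ((TensorPower.algebraMap₀_mul r (toLinearMap f a)).trans ?_)
  exact (map_smul (toLinearMap f) r a).symm.trans
    (congrArg (toLinearMap f) (TensorPower.algebraMap₀_mul r a).symm)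

lemma tensor_unit {X Y : TensorPowerCategory n} (f : X ⟶ Y) :
    toLinearMap (tensor f (𝟙 (of 0 : TensorPowerCategory n)) ≫
        eqToHom (congrArg of (add_zero Y.power))) =
      toLinearMap (eqToHom (congrArg of (add_zero X.power)) ≫ f) := by
  refine tensorPower_hom_ext fun a u => ?_
  obtain ⟨r, rfl⟩ := TensorPower.algebraMap₀.surjective u
  rw [toLinearMap_comp, toLinearMap_comp, toLinearMap_eqToHom (add_zero _),
    toLinearMap_eqToHom (add_zero _), LinearMap.comp_apply, LinearMap.comp_apply]
  refine (congrArg _ (tensorMap_mulEquiv _ _ _ _)).trans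
    ((TensorPower.mul_algebraMap₀ r (toLinearMap f a)).trans ?_)
  exact (map_smul (toLinearMap f) r a).symm.trans
    (congrArg (toLinearMap f) (TensorPower.mul_algebraMap₀ r a).symm)

instance : StrictLinearMonoidalCategory ℝ (TensorPowerCategory n) where
  tensorObj X Y := of (X.power + Y.power)
  tensorUnit := of 0
  tensorHom f g := tensor f g
  tensorHom_id _ _ := hom_ext <| tensorPower_hom_ext fun a b =>
    tensorMap_mulEquiv LinearMap.id LinearMap.id a b
  tensorHom_comp f g f' g' := hom_ext <| tensorPower_hom_ext fun a b => by
    simp only [toLinearMap_tensor, toLinearMap_comp, LinearMap.comp_apply, tensorMap_mulEquiv]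
  tensorObj_assoc X Y Z := congrArg of (add_assoc _ _ _)
  unit_tensorObj X := congrArg of (zero_add _)
  tensorObj_unit X := congrArg of (add_zero _)
  tensorHom_assoc f g h := hom_ext <| tensor_assoc f g h
  unit_tensorHom f := hom_ext <| unit_tensor f
  tensorHom_unit f := hom_ext <| tensor_unit f
  add_tensorHom f f' g := hom_ext <| tensorPower_hom_ext fun a b => by
    simp only [toLinearMap_tensor, toLinearMap_add, LinearMap.add_apply, tensorMap_mulEquiv,
      TensorProduct.add_tmul, map_add]
  tensorHom_add f g g' := hom_ext <| tensorPower_hom_ext fun a b => by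
    simp only [toLinearMap_tensor, toLinearMap_add, LinearMap.add_apply, tensorMap_mulEquiv,
      TensorProduct.tmul_add, map_add]
  smul_tensorHom r f g := hom_ext <| tensorPower_hom_ext fun a b => by
    simp only [toLinearMap_tensor, toLinearMap_smul, LinearMap.smul_apply, tensorMap_mulEquiv,
      ← TensorProduct.smul_tmul', map_smul]
  tensorHom_smul r f g := hom_ext <| tensorPower_hom_ext fun a b => by
    simp only [toLinearMap_tensor, toLinearMap_smul, LinearMap.smul_apply, tensorMap_mulEquiv,
      TensorProduct.tmul_smul, map_smul]

end TensorPowerCategory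

/-! ### The matrices of partition diagrams -/

/-- The standard basis `e_I = e_{i_1} ⊗ ⋯ ⊗ e_{i_k}` of the `k`-th tensor power of `ℝⁿ`, indexed by
the tuples `I ∈ [n]^k`. -/
def tensorBasis (n k : ℕ) : Module.Basis (Fin k → Fin n) ℝ (⨂[ℝ]^k (Fin n → ℝ)) :=
  Basis.piTensorProduct fun _ => Pi.basisFun ℝ (Fin n)

open Classical in
/-- The matrix `∑_{I, J} δ_{π, (I, J)} E_{I, J}`, where `E_{I, J}` are the matrix units and
`δ_{π, (I, J)}` is `1` if the labelling `(I, J)` of the vertices (`I` on the top row, `J` on the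
bottom row) takes equal values on any two vertices in the same block of `π`, and `0` otherwise. -/
def diagramMatrix (n : ℕ) {k l : ℕ} (π : PartitionDiagram k l) :
    Matrix (Fin l → Fin n) (Fin k → Fin n) ℝ :=
  Matrix.of fun I J =>
    if ∀ x y : Fin l ⊕ Fin k, π x y → Sum.elim I J x = Sum.elim I J y then 1 else 0

/-- The linear map `E_π` from the `k`-th to the `l`-th tensor power of `ℝⁿ`, given by its matrix in
the standard bases. -/
def diagramMap (n : ℕ) {k l : ℕ} (π : PartitionDiagram k l) :
    ⨂[ℝ]^k (Fin n → ℝ) →ₗ[ℝ] ⨂[ℝ]^l (Fin n → ℝ) :=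
  Matrix.toLin (tensorBasis n k) (tensorBasis n l) (diagramMatrix n π)

end

open CategoryTheory Diagram

/-!
The matrix of `E_π` has as its `(I, J)` entry the indicator that the labelling `(I, J)` of the
vertices is constant on the blocks of `π`, that is, that `π` is finer than its partition into level
sets `Setoid.ker (Sum.elim I J)`. These are the 0-1 matrices `colourMatrix (Fin n) π`, so
`E_{π₂} ∘ E_{π₁} = n ^ c(π₂, π₁) E_{π₂ ∘ π₁}` says that `n ^ c` labellings of the middle row are
compatible with a compatible labelling of the outer rows (`colourMatrix_mul`). In the same way,
`E_π ⊗ E_τ` is the map of the juxtaposed diagram, as a labelling of the juxtaposed diagram is a pair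
of labellings. Hence the linear extension `realize` of `π ↦ E_π` is a strict monoidal functor; its
values are equivariant because level sets do not change when the labels are permuted.

For fullness, a linear map is equivariant if and only if its matrix is invariant under permutations
of the labels (`isIntertwining_iff_toMatrix`). Labellings with the same level sets differ by a
permutation of the labels (`exists_perm_comp_eq`), so an invariant matrix is a linear combination of
the matrices `orbitMatrix n π` that are the indicators of the labellings with level sets exactly `π`.
Since `E_π` is the sum of the orbit matrices of all `τ ≥ π`, downward induction on `π` puts every
orbit matrix in the span of the `E_τ` (`orbitMatrix_mem_span`).
-/

namespace Diagram

variable {n : ℕ}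

/-! ### Multiplicativity of the diagram matrices -/

lemma diagramMatrix_apply {k l : ℕ} (π : PartitionDiagram k l) (I : Fin l → Fin n)
    (J : Fin k → Fin n) [Decidable (π ≤ Setoid.ker (Sum.elim I J))] :
    diagramMatrix n π I J = if π ≤ Setoid.ker (Sum.elim I J) then 1 else 0 := by
  rw [diagramMatrix, Matrix.of_apply]
  congr 1

lemma diagramMatrix_eq_map {k l : ℕ} (π : PartitionDiagram k l) :
    diagramMatrix n π = (colourMatrix (Fin n) π).map (Nat.castRingHom ℝ) := by
  classical
  ext I J
  rw [diagramMatrix_apply, Matrix.map_apply, colourMatrix]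
  split_ifs <;> simp

lemma diagramMatrix_mul {k l m : ℕ} (π₂ : PartitionDiagram l m) (π₁ : PartitionDiagram k l) :
    diagramMatrix n π₂ * diagramMatrix n π₁ =
      (n : ℝ) ^ numRemoved π₂ π₁ • diagramMatrix n (vcomp π₂ π₁) := by
  simp only [diagramMatrix_eq_map]
  rw [← Matrix.map_mul, colourMatrix_mul]
  ext I J
  simp

lemma diagramMatrix_hcomp {k l q m : ℕ} (π : PartitionDiagram k l) (τ : PartitionDiagram q m)
    (I : Fin l → Fin n) (I' : Fin m → Fin n) (J : Fin k → Fin n) (J' : Fin q → Fin n) :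
    diagramMatrix n (hcomp π τ) (Fin.append I I') (Fin.append J J') =
      diagramMatrix n π I J * diagramMatrix n τ I' J' := by
  simp only [diagramMatrix_eq_map, Matrix.map_apply, colourMatrix_hcomp, map_mul]

lemma diagramMap_idDiagram (k : ℕ) :
    diagramMap n (idDiagram : PartitionDiagram k k) = LinearMap.id := by
  rw [diagramMap, diagramMatrix_eq_map, colourMatrix_id, Matrix.map_one _ (map_zero _) (map_one _),
    Matrix.toLin_one]

lemma diagramMap_comp {k l m : ℕ} (π₂ : PartitionDiagram l m) (π₁ : PartitionDiagram k l) :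
    diagramMap n π₂ ∘ₗ diagramMap n π₁ =
      (n : ℝ) ^ numRemoved π₂ π₁ • diagramMap n (vcomp π₂ π₁) := by
  rw [diagramMap, diagramMap, ← Matrix.toLin_mul, diagramMatrix_mul, map_smul, diagramMap]

/-! ### Tensor products of the diagram maps -/

lemma mulEquiv_tensorBasis {k q : ℕ} (J : Fin k → Fin n) (J' : Fin q → Fin n) :
    TensorPower.mulEquiv (tensorBasis n k J ⊗ₜ tensorBasis n q J') =
      tensorBasis n (k + q) (Fin.append J J') := by
  simp only [tensorBasis, Basis.piTensorProduct_apply, ← TensorPower.gMul_def,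
    TensorPower.tprod_mul_tprod]
  congr 1
  funext i
  refine Fin.addCases (fun j => ?_) (fun j => ?_) i <;> simp

lemma diagramMap_tensorBasis {k l : ℕ} (π : PartitionDiagram k l) (J : Fin k → Fin n) :
    diagramMap n π (tensorBasis n k J) = ∑ I, diagramMatrix n π I J • tensorBasis n l I :=
  Matrix.toLin_self _ _ _ _

lemma tensorMap_diagramMap {k l q m : ℕ} (π : PartitionDiagram k l) (τ : PartitionDiagram q m) :
    TensorPowerCategory.tensorMap (diagramMap n π) (diagramMap n τ) =
      diagramMap n (hcomp π τ) := by
  refine (tensorBasis n (k + q)).ext fun u => ?_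
  obtain ⟨⟨J, J'⟩, rfl⟩ := (Fin.appendEquiv k q).surjective u
  change TensorPowerCategory.tensorMap _ _ (tensorBasis n _ (Fin.append J J')) =
    diagramMap n _ (tensorBasis n _ (Fin.append J J'))
  rw [diagramMap_tensorBasis, ← mulEquiv_tensorBasis, TensorPowerCategory.tensorMap_mulEquiv,
    diagramMap_tensorBasis, diagramMap_tensorBasis, TensorProduct.sum_tmul, map_sum,
    ← (Fin.appendEquiv l m).sum_comp, Fintype.sum_prod_type]
  refine Finset.sum_congr rfl fun I _ => ?_
  rw [TensorProduct.tmul_sum, map_sum]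
  refine Finset.sum_congr rfl fun I' _ => ?_
  rw [TensorProduct.smul_tmul_smul, map_smul, mulEquiv_tensorBasis]
  exact congrArg (· • _) (diagramMatrix_hcomp π τ I I' J J').symm

/-! ### Equivariance -/

lemma tensorRep_tensorBasis {k : ℕ} (σ : Equiv.Perm (Fin n)) (J : Fin k → Fin n) :
    tensorRep n k σ (tensorBasis n k J) = tensorBasis n k (σ ∘ J) := by
  simp only [tensorBasis, Basis.piTensorProduct_apply]
  refine (PiTensorProduct.map_tprod _ _).trans (congrArg _ (funext fun i => funext fun j => ?_))
  simp [permRep, LinearMap.funLeft, Pi.single_apply, Equiv.symm_apply_eq]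

/-- A linear map between tensor powers is equivariant if and only if its matrix is invariant under
simultaneous relabelling of both rows. -/
lemma isIntertwining_iff_toMatrix {k l : ℕ}
    (f : ⨂[ℝ]^k (Fin n → ℝ) →ₗ[ℝ] ⨂[ℝ]^l (Fin n → ℝ)) :
    (∀ σ, f ∘ₗ tensorRep n k σ = tensorRep n l σ ∘ₗ f) ↔
      ∀ (σ : Equiv.Perm (Fin n)) I J,
        LinearMap.toMatrix (tensorBasis n k) (tensorBasis n l) f (σ ∘ I) (σ ∘ J) =
          LinearMap.toMatrix (tensorBasis n k) (tensorBasis n l) f I J := by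
  have repr_tensorRep : ∀ (σ : Equiv.Perm (Fin n)) (v : ⨂[ℝ]^l (Fin n → ℝ)) (I : Fin l → Fin n),
      (tensorBasis n l).repr (tensorRep n l σ v) (σ ∘ I) = (tensorBasis n l).repr v I := by
    intro σ v I
    have h : (tensorBasis n l).coord (σ ∘ I) ∘ₗ tensorRep n l σ = (tensorBasis n l).coord I := by
      refine (tensorBasis n l).ext fun I' => ?_
      rw [LinearMap.comp_apply, tensorRep_tensorBasis, Module.Basis.coord_apply,
        Module.Basis.coord_apply, Module.Basis.repr_self, Module.Basis.repr_self,
        Finsupp.single_apply, Finsupp.single_apply]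
      simp only [σ.injective.comp_left.eq_iff]
    exact LinearMap.congr_fun h v
  simp only [LinearMap.toMatrix_apply]
  constructor
  · intro h σ I J
    rw [← tensorRep_tensorBasis, ← LinearMap.comp_apply, h, LinearMap.comp_apply, repr_tensorRep]
  · intro h σ
    refine (tensorBasis n k).ext fun J => (tensorBasis n l).ext_elem fun I => ?_
    obtain ⟨I, rfl⟩ : ∃ I', σ ∘ I' = I := ⟨σ.symm ∘ I, by ext i; simp⟩
    rw [LinearMap.comp_apply, LinearMap.comp_apply, tensorRep_tensorBasis, h, repr_tensorRep]

lemma diagramMatrix_comp_perm {k l : ℕ} (π : PartitionDiagram k l) (σ : Equiv.Perm (Fin n))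
    (I : Fin l → Fin n) (J : Fin k → Fin n) :
    diagramMatrix n π (σ ∘ I) (σ ∘ J) = diagramMatrix n π I J := by
  classical
  have h : Setoid.ker (Sum.elim (σ ∘ I) (σ ∘ J)) = Setoid.ker (Sum.elim I J) := by
    ext x y
    rw [Setoid.ker_def, Setoid.ker_def, ← Sum.comp_elim]
    exact σ.injective.eq_iff
  simp only [diagramMatrix_apply, h]

lemma diagramMap_isIntertwining {k l : ℕ} (π : PartitionDiagram k l) (σ : Equiv.Perm (Fin n)) :
    diagramMap n π ∘ₗ tensorRep n k σ = tensorRep n l σ ∘ₗ diagramMap n π := by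
  refine (isIntertwining_iff_toMatrix _).2 (fun σ I J => ?_) σ
  rw [diagramMap, LinearMap.toMatrix_toLin, diagramMatrix_comp_perm]

/-! ### Invariant matrices are spanned by the diagram matrices -/

instance finite_setoid {V : Type*} [Finite V] : Finite (Setoid V) :=
  Finite.of_injective (fun π : Setoid V => fun a b => π a b) fun _ _ h =>
    Setoid.ext fun a b => iff_of_eq (congrFun₂ h a b)

/-- Labellings of a set that induce the same set partition differ by a permutation of the labels:
the bijection between their ranges extends, as the set of labels is finite. -/
lemma exists_perm_comp_eq {V A : Type*} [Finite A] {f g : V → A}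
    (h : Setoid.ker f = Setoid.ker g) : ∃ σ : Equiv.Perm A, σ ∘ f = g := by
  classical
  have := Fintype.ofFinite A
  let e : {a // a ∈ Set.range f} ≃ {a // a ∈ Set.range g} :=
    (Setoid.quotientKerEquivRange f).symm.trans
      ((Quotient.congrRight fun a b => by rw [h]).trans
        (Setoid.quotientKerEquivRange g))
  refine ⟨e.extendSubtype, funext fun v => ?_⟩
  rw [Function.comp_apply, e.extendSubtype_apply_of_mem _ ⟨v, rfl⟩]
  have : (Setoid.quotientKerEquivRange f).symm ⟨f v, v, rfl⟩ = Quotient.mk _ v := by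
    rw [Equiv.symm_apply_eq]; rfl
  simp only [e, Equiv.trans_apply, this]
  rfl

open Classical in
/-- The indicator matrix of the pairs of labellings whose set partition into level sets is exactly
`π`. When it is non-zero, it is the indicator of an orbit of the symmetric group on such pairs. -/
noncomputable def orbitMatrix (n : ℕ) {k l : ℕ} (π : PartitionDiagram k l) :
    Matrix (Fin l → Fin n) (Fin k → Fin n) ℝ :=
  Matrix.of fun I J => if Setoid.ker (Sum.elim I J) = π then 1 else 0

/-- By Möbius inversion on the lattice of set partitions: a labelling is constant on the blocks of
`π` if and only if its level sets form a partition that is equal to or coarser than `π`. -/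
lemma orbitMatrix_mem_span {k l : ℕ} (π : PartitionDiagram k l) :
    orbitMatrix n π ∈ Submodule.span ℝ (Set.range (diagramMatrix n (k := k) (l := l))) := by
  classical
  have := Fintype.ofFinite (PartitionDiagram k l)
  induction π using WellFoundedGT.induction with
  | ind π ih =>
  have key : diagramMatrix n π = orbitMatrix n π + ∑ τ with π < τ, orbitMatrix n τ := by
    ext I J
    rw [diagramMatrix_apply, Matrix.add_apply, Matrix.sum_apply]
    simp only [orbitMatrix, Matrix.of_apply, Finset.sum_ite_eq, Finset.mem_filter, Finset.mem_univ,
      true_and, le_iff_eq_or_lt (a := π), eq_comm (a := π)]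
    by_cases h : Setoid.ker (Sum.elim I J) = π <;> simp [h]
  rw [← sub_eq_of_eq_add key]
  exact Submodule.sub_mem _ (Submodule.subset_span ⟨π, rfl⟩)
    (Submodule.sum_mem _ fun τ hτ => ih τ (Finset.mem_filter.1 hτ).2)

/-- An invariant matrix is constant on the pairs of labellings with a given partition into level
sets, hence a linear combination of the orbit matrices. -/
lemma mem_span_diagramMatrix {k l : ℕ} {M : Matrix (Fin l → Fin n) (Fin k → Fin n) ℝ}
    (hM : ∀ (σ : Equiv.Perm (Fin n)) I J, M (σ ∘ I) (σ ∘ J) = M I J) :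
    M ∈ Submodule.span ℝ (Set.range (diagramMatrix n (k := k) (l := l))) := by
  classical
  have := Fintype.ofFinite (PartitionDiagram k l)
  -- The value of `M` at some, hence any, pair of labellings with level sets `π`; partitions with
  -- more than `n` blocks have no such pair, and their orbit matrix is zero.
  let c : PartitionDiagram k l → ℝ := fun π =>
    if h : ∃ w : Fin l ⊕ Fin k → Fin n, Setoid.ker w = π then
      M (h.choose ∘ Sum.inl) (h.choose ∘ Sum.inr) else 0
  have hc : ∀ I J, c (Setoid.ker (Sum.elim I J)) = M I J := by
    intro I J
    have h : ∃ w : Fin l ⊕ Fin k → Fin n, Setoid.ker w = Setoid.ker (Sum.elim I J) := ⟨_, rfl⟩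
    obtain ⟨σ, hσ⟩ := exists_perm_comp_eq h.choose_spec
    simp only [c, dif_pos h]
    rw [← hM σ, ← Function.comp_assoc, ← Function.comp_assoc, hσ, Sum.elim_comp_inl,
      Sum.elim_comp_inr]
  have key : M = ∑ π, c π • orbitMatrix n π := by
    ext I J
    simp [Matrix.sum_apply, orbitMatrix, hc]
  rw [key]
  exact Submodule.sum_mem _ fun π _ => Submodule.smul_mem _ _ (orbitMatrix_mem_span π)

/-! ### The functor -/

/-- The linear extension of `π ↦ E_π` to the partition space. -/
noncomputable def realize (n k l : ℕ) :
    PartitionSpace k l →ₗ[ℝ] ⨂[ℝ]^k (Fin n → ℝ) →ₗ[ℝ] ⨂[ℝ]^l (Fin n → ℝ) :=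
  Finsupp.linearCombination ℝ (diagramMap n)

lemma realize_diagramVector {k l : ℕ} (π : PartitionDiagram k l) :
    realize n k l (diagramVector π) = diagramMap n π := by
  simp [realize, diagramVector]

lemma realize_isIntertwining {k l : ℕ} (f : PartitionSpace k l) (σ : Equiv.Perm (Fin n)) :
    realize n k l f ∘ₗ tensorRep n k σ = tensorRep n l σ ∘ₗ realize n k l f := by
  induction f using PartitionSpace.induction with
  | h₀ π => rw [realize_diagramVector, diagramMap_isIntertwining]
  | h₁ f g hf hg => rw [map_add, LinearMap.add_comp, LinearMap.comp_add, hf, hg]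
  | h₂ r f hf => rw [map_smul, LinearMap.smul_comp, LinearMap.comp_smul, hf]

lemma realize_diagramComp {k l m : ℕ} (g : PartitionSpace l m) (f : PartitionSpace k l) :
    realize n k m (diagramComp n g f) = realize n l m g ∘ₗ realize n k l f := by
  induction g using PartitionSpace.induction with
  | h₁ g g' hg hg' => simp only [map_add, LinearMap.add_apply, LinearMap.add_comp, hg, hg']
  | h₂ r g hg => simp only [map_smul, LinearMap.smul_apply, LinearMap.smul_comp, hg]
  | h₀ π₂ =>
  induction f using PartitionSpace.induction with
  | h₁ f f' hf hf' => simp only [map_add, LinearMap.comp_add, hf, hf']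
  | h₂ r f hf => simp only [map_smul, LinearMap.comp_smul, hf]
  | h₀ π₁ =>
  rw [diagramComp_diagramVector, map_smul, realize_diagramVector, realize_diagramVector,
    realize_diagramVector, diagramMap_comp]

lemma realize_diagramTensor {k l q m : ℕ} (f : PartitionSpace k l) (g : PartitionSpace q m) :
    realize n (k + q) (l + m) (diagramTensor f g) =
      TensorPowerCategory.tensorMap (realize n k l f) (realize n q m g) := by
  induction f using PartitionSpace.induction with
  | h₁ f f' hf hf' =>
    simp only [map_add, LinearMap.add_apply, hf, hf', TensorPowerCategory.tensorMap,
      TensorProduct.map_add_left, LinearMap.add_comp, LinearMap.comp_add]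
  | h₂ r f hf =>
    simp only [map_smul, LinearMap.smul_apply, hf, TensorPowerCategory.tensorMap,
      TensorProduct.map_smul_left, LinearMap.smul_comp, LinearMap.comp_smul]
  | h₀ π =>
  induction g using PartitionSpace.induction with
  | h₁ g g' hg hg' =>
    simp only [map_add, hg, hg', TensorPowerCategory.tensorMap,
      TensorProduct.map_add_right, LinearMap.add_comp, LinearMap.comp_add]
  | h₂ r g hg =>
    simp only [map_smul, hg, TensorPowerCategory.tensorMap,
      TensorProduct.map_smul_right, LinearMap.smul_comp, LinearMap.comp_smul]
  | h₀ τ =>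
  rw [diagramTensor_diagramVector, realize_diagramVector, realize_diagramVector,
    realize_diagramVector, tensorMap_diagramMap]

lemma exists_realize_eq {k l : ℕ} (f : ⨂[ℝ]^k (Fin n → ℝ) →ₗ[ℝ] ⨂[ℝ]^l (Fin n → ℝ))
    (hf : ∀ σ, f ∘ₗ tensorRep n k σ = tensorRep n l σ ∘ₗ f) : ∃ p, realize n k l p = f := by
  have h := mem_span_diagramMatrix ((isIntertwining_iff_toMatrix f).1 hf)
  obtain ⟨p, hp⟩ := Finsupp.mem_span_range_iff_exists_finsupp.1 h
  refine ⟨p, ?_⟩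
  rw [← Matrix.toLin_toMatrix (tensorBasis n k) (tensorBasis n l) f, ← hp, Finsupp.sum, map_sum,
    realize, Finsupp.linearCombination_apply, Finsupp.sum]
  exact Finset.sum_congr rfl fun π _ => (map_smul _ _ _).symm

/-- The functor from the partition category to the category of tensor powers of `ℝⁿ` that is the
identity on the labels `k` of the objects and the linear extension of `d_π ↦ E_π` on morphisms. -/
noncomputable def realizationFunctor (n : ℕ) : PartitionCategory n ⥤ TensorPowerCategory n where
  obj X := TensorPowerCategory.of X.rank
  map {X Y} f :=
    { toLinearMap := realize n X.rank Y.rank f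
      isIntertwining' := realize_isIntertwining (k := X.rank) (l := Y.rank) f }
  map_id X := TensorPowerCategory.hom_ext
    ((realize_diagramVector _).trans (diagramMap_idDiagram X.rank))
  map_comp f g := TensorPowerCategory.hom_ext (realize_diagramComp g f)

lemma toLinearMap_realizationFunctor_map {X Y : PartitionCategory n} (f : X ⟶ Y) :
    TensorPowerCategory.toLinearMap ((realizationFunctor n).map f) =
      realize n X.rank Y.rank f := rfl

lemma realizationFunctor_full (n : ℕ) : (realizationFunctor n).Full where
  map_surjective {X Y} f := by
    obtain ⟨p, hp⟩ := exists_realize_eq (TensorPowerCategory.toLinearMap f)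
      (Representation.IntertwiningMap.isIntertwining' f)
    exact ⟨p, TensorPowerCategory.hom_ext hp⟩

lemma realizationFunctor_isStrictLinearMonoidal (n : ℕ) :
    IsStrictLinearMonoidalFunctor ℝ (realizationFunctor n) where
  map_tensorObj _ _ := rfl
  map_tensorHom f g := by
    -- The functor is the identity on labels, so both transports are definitionally identities.
    refine (Category.comp_id _).trans (Eq.trans ?_ (Category.id_comp _).symm)
    exact TensorPowerCategory.hom_ext (realize_diagramTensor f g)
  map_tensorUnit := rfl
  map_add f g := TensorPowerCategory.hom_ext (map_add (realize n _ _) f g)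
  map_smul r f := TensorPowerCategory.hom_ext (map_smul (realize n _ _) r f)

end Diagram

/-- For `n ≥ 1` there is a full, strict `ℝ`-linear monoidal functor from the partition category
`𝒫(n)` to `𝒞(S_n)` that sends `k` to the `k`-th tensor power of `ℝⁿ` with its representation of `S_n`
and `d_π` to `E_π`. -/
theorem theorem5 (n : ℕ) (hn : 1 ≤ n) :
    ∃ Θ : PartitionCategory n ⥤ TensorPowerCategory n,
      Θ.Full ∧ IsStrictLinearMonoidalFunctor ℝ Θ ∧
      ∃ hobj : ∀ k : ℕ, Θ.obj (PartitionCategory.of k) = TensorPowerCategory.of k,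
        ∀ (k l : ℕ) (π : PartitionDiagram k l),
          TensorPowerCategory.toLinearMap
            (eqToHom (hobj k).symm ≫ Θ.map (PartitionCategory.diagram π) ≫ eqToHom (hobj l)) =
          diagramMap n π := by
  refine ⟨realizationFunctor n, realizationFunctor_full n,
    realizationFunctor_isStrictLinearMonoidal n, fun _ => rfl, fun k l π => ?_⟩
  -- The transports along `hobj` are definitionally identities.
  refine (congrArg TensorPowerCategory.toLinearMap
    ((Category.id_comp _).trans (Category.comp_id _))).trans ?_
  exact realize_diagramVector π
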